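/- **Conventions.** A cardinal is identified with the set of ordinals below it. A structure $\langle\delta,\langle\lambda_i:i<\delta\rangle,\langle f_\alpha:\alpha<\lambda\rangle,J,\langle A_\zeta:\zeta<\kappa\rangle\rangle$ is a *strong $\lambda$-system for $\kappa$* if: $\delta$ is a limit ordinal with $|\delta|<\lambda$; $\langle\lambda_i:i<\delta\rangle$ is a strictly increasing sequence of regular cardinals; the $f_\alpha\in\prod_{i<\delta}\lambda_i$ are pairwise distinct; $J$ is a proper ideal on $\delta$ containing all bounded subsets of $\delta$; $\langle f_\alpha:\alpha<\lambda\rangle$ is $<_J$-increasing and cofinal in $\prod_{i<\delta}(\lambda_i,<)/J$; $|\{f_\alpha{\restriction} i:\alpha<\lambda\}|<\lambda_i$ for every $i<\delta$ (in particular it is $\le\sup_{j<\delta}\lambda_j$); $\mathrm{cf}(\delta)\le\kappa$ and $\sup_{i<\delta}\lambda_i\le 2^\kappa$; and the sets $A_\zeta\subseteq\delta$ ($\zeta<\kappa$) are pairwise disjoint and not in $J$. For a Boolean algebra $B$: - $\mathrm{inv}^+_{T_{\mathrm{h\text{-}cof}}}(B)$ is the supremum of the successor cardinals $|P|^+$ over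 all $P\subseteq B$ that carry a strict well ordering $\prec$ such that $x<_By\Rightarrow x\prec y$ for all $x,y\in P$. - $s^+_\omega(B)$ is the supremum of $|P|^+$ over all ideal-independent $P\subseteq B$, i.e. those for which $x_0\not\le x_1\vee\dots\vee x_{n}$ for all $n\ge1$ and all distinct $x_0,\dots,x_n\in P$. - $\mathrm{h\text{-}cof}(B)$ is the least cardinal $\chi$ such that every $X\subseteq B$ has a subset $C$ with $|C|\le\chi$ that is cofinal in $X$ (every $x\in X$ is below some $c\in C$). - $\mathrm{Inc}(B)$ is the supremum of $|X|$ over all $X\subseteq B$ whose distinct elements are pairwise incomparable. **Theorem.** Let $\lambda$ be a regular cardinal, let $\kappa$ be a cardinal for which there exists a strong $\lambda$-system for $\kappa$, and let $\theta\le\kappa$ be an infinite cardinal. Then there are infinite Boolean algebras $B_\varepsilon$ ($\varepsilon<\theta$) such that $\mathrm{inv}^+_{T_{\mathrm{h\text{-}cof}}}(B_\varepsilon)\le\lambda$ for all $\varepsilon<\theta$, and such that for every ultrafilter $D$ on $\theta$ containing all co-bounded subsets of $\theta$ $$s^+_\omega\Big(\prod_{\varepsilon<\theta}B_\varepsilon/D\Big)>\lambda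 .$$ Moreover, for these algebras and every such $D$: if $\lambda=\mu^+$ for a cardinal $\mu$ with $\mu^\theta=\mu$, then, writing $\prod_{\varepsilon<\theta}\chi_\varepsilon/D$ for the cardinality of the ultraproduct of the cardinals $\chi_\varepsilon$, $$\prod_{\varepsilon<\theta}\mathrm{h\text{-}cof}(B_\varepsilon)/D<\mathrm{h\text{-}cof}\Big(\prod_{\varepsilon<\theta}B_\varepsilon/D\Big)\quad\text{and}\quad \prod_{\varepsilon<\theta}\mathrm{Inc}(B_\varepsilon)/D<\mathrm{Inc}\Big(\prod_{\varepsilon<\theta}B_\varepsilon/D\Big).$$ -/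

import Mathlib

open Cardinal

universe u v

/-! ### Systems of functions from pcf theory

An ordinal `δ` is used through its canonical well ordered type `δ.ToType`, and a cardinal `c`,
viewed as the set of ordinals below it, through `c.ord.ToType`. -/

/-- The set of restrictions `{f_α ↾ i : α}` of a family `f` of functions on a linear order. -/
def restrictions {A : Type*} {I : Type*} [LinearOrder I] {X : I → Type*}
    (f : A → ∀ i, X i) (i : I) : Set (∀ j : Set.Iio i, X j) :=
  Set.range fun (a : A) (j : Set.Iio i) => f a j

/-- A weak `lam`-system `⟨δ, ⟨λ_i : i < δ⟩, ⟨f_α : α < lam⟩⟩`. -/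
structure WeakLambdaSystem (lam : Cardinal.{u}) where
  δ : Ordinal.{u}
  isSuccLimit : Order.IsSuccLimit δ
  card_lt : δ.card < lam
  lamSeq : δ.ToType → Cardinal.{u}
  strictMono : StrictMono lamSeq
  isRegular : ∀ i, (lamSeq i).IsRegular
  f : lam.ord.ToType → ∀ i, (lamSeq i).ord.ToType
  injective : Function.Injective f
  card_restrictions_le : ∀ i, #(restrictions f i) ≤ ⨆ j, lamSeq j

/-- A `lam`-system: a weak `lam`-system together with a (proper) ideal `J` on `δ` containing all
bounded sets, such that `f` is `<_J`-increasing and cofinal in the product modulo `J`. -/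
structure LambdaSystem (lam : Cardinal.{u}) extends WeakLambdaSystem lam where
  J : Order.Ideal (Set δ.ToType)
  univ_notMem : Set.univ ∉ J
  bounded_mem : ∀ s : Set δ.ToType, BddAbove s → s ∈ J
  increasing : ∀ α β, α < β → {i | ¬ f α i < f β i} ∈ J
  cofinal : ∀ g : ∀ i, (lamSeq i).ord.ToType, ∃ α, {i | ¬ g i ≤ f α i} ∈ J
  card_restrictions_lt : ∀ i, #(restrictions f i) < lamSeq i

/-- A strong `lam`-system for `κ`. -/
structure StrongLambdaSystem (lam κ : Cardinal.{u}) extends LambdaSystem lam where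
  cof_le : δ.cof ≤ κ
  iSup_le : ⨆ i, lamSeq i ≤ 2 ^ κ
  A : κ.ord.ToType → Set δ.ToType
  A_notMem : ∀ ζ, A ζ ∉ J
  A_disjoint : Pairwise fun ζ ξ => Disjoint (A ζ) (A ξ)

/-! ### Cardinal invariants of Boolean algebras -/

section Invariants

variable (B : Type u) [BooleanAlgebra B]

/-- A theory in the language of Boolean algebras with a unary predicate `P₀` and a binary
predicate `P₁`, as the class of the expansions `(B, P₀, P₁)` that satisfy it. -/
abbrev BATheory : Type (u + 1) :=
  ∀ (B : Type u) [BooleanAlgebra B], Set B → (B → B → Prop) → Prop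

/-- `inv_T(B) = sup {|P₀| : (B, P₀, P₁) is a model of T}`. -/
noncomputable def baInv (T : BATheory.{u}) : Cardinal.{u} :=
  ⨆ P : {P : Set B // ∃ R : B → B → Prop, T B P R}, #P.1

/-- `inv⁺_T(B) = sup {|P₀|⁺ : (B, P₀, P₁) is a model of T}`. -/
noncomputable def baInvPlus (T : BATheory.{u}) : Cardinal.{u} :=
  ⨆ P : {P : Set B // ∃ R : B → B → Prop, T B P R}, Order.succ #P.1

/-- The theory of hereditary cofinality: `P₁` is a (strict) well ordering of `P₀`, and `x < y`
in `B` implies `P₁ x y` for `x, y ∈ P₀`. -/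
def theoryHCof : BATheory.{u} := fun _ _ P R =>
  IsWellOrder P (fun x y : P => R x y) ∧ ∀ x ∈ P, ∀ y ∈ P, x < y → R x y

/-- No member of `P` is covered by the union of `k + 1` other members of `P`. -/
def spreadFormula {B : Type u} [BooleanAlgebra B] (k : ℕ) (P : Set B) : Prop :=
  ∀ x ∈ P, ∀ y : Fin (k + 1) → B, Function.Injective y → (∀ j, y j ∈ P ∧ y j ≠ x) →
    ¬ x ≤ Finset.univ.sup y

/-- The theories `T_s^n`, for `n ≤ ω`, of the spread. -/
def theorySpread (n : ℕ∞) : BATheory.{u} := fun _ _ P _ =>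
  ∀ k : ℕ, (k : ℕ∞) < n → spreadFormula k P

/-- `s⁺_n(B)`, for `n ≤ ω`; here `ω` is `⊤`. -/
noncomputable def spreadPlus (n : ℕ∞) : Cardinal.{u} := baInvPlus B (theorySpread n)

/-- The theory of incomparability: distinct members of `P₀` are incomparable. -/
def theoryInc : BATheory.{u} := fun _ _ P _ => ∀ x ∈ P, ∀ y ∈ P, x ≠ y → ¬ x ≤ y

/-- The incomparability number `Inc(B)`. -/
noncomputable def incomparability : Cardinal.{u} := baInv B theoryInc

/-- The hereditary cofinality `h-cof(B)`: the least `κ` such that every subset of `B` has a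
cofinal subset of size at most `κ`. -/
noncomputable def hereditaryCofinality : Cardinal.{u} :=
  sInf {κ | ∀ X : Set B, ∃ C ⊆ X, #C ≤ κ ∧ ∀ x ∈ X, ∃ c ∈ C, x ≤ c}

end Invariants

/-! ### Ultraproducts of Boolean algebras -/

section Ultraproduct

variable {I : Type v} (l : Filter I) (B : I → Type u) [∀ i, BooleanAlgebra (B i)]

/-- The pointwise Boolean algebra structure on the product of Boolean algebras modulo a filter. -/
noncomputable instance Filter.Product.instBooleanAlgebra : BooleanAlgebra (l.Product B) where
  le := Quotient.lift₂ (fun f g => ∀ᶠ i in l, f i ≤ g i) (by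
    intro f g f' g' hf hg
    refine propext (Filter.eventually_congr ?_)
    filter_upwards [hf, hg] with i h1 h2
    rw [h1, h2])
  le_refl x := by
    induction x using Quotient.inductionOn
    exact Filter.Eventually.of_forall fun _ => le_rfl
  le_trans x y z := by
    induction x, y using Quotient.inductionOn₂
    induction z using Quotient.inductionOn
    intro h1 h2
    exact Filter.Eventually.mp h1 (Filter.Eventually.mono h2 fun _ h h' => h'.trans h)
  le_antisymm x y := by
    induction x, y using Quotient.inductionOn₂
    intro h1 h2
    refine Quotient.sound ?_
    exact Filter.Eventually.mp h1 (Filter.Eventually.mono h2 fun _ h h' => le_antisymm h' h)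
  sup := Quotient.map₂ (fun f g i => f i ⊔ g i) (by
    intro f f' hf g g' hg
    exact Filter.Eventually.mp hf (Filter.Eventually.mono hg fun _ h h' => by simp only [h, h']))
  inf := Quotient.map₂ (fun f g i => f i ⊓ g i) (by
    intro f f' hf g g' hg
    exact Filter.Eventually.mp hf (Filter.Eventually.mono hg fun _ h h' => by simp only [h, h']))
  compl := Quotient.map (fun f i => (f i)ᶜ) (by
    intro f f' hf
    exact Filter.Eventually.mono hf fun _ h => by simp only [h])
  top := Quotient.mk _ fun _ => ⊤
  bot := Quotient.mk _ fun _ => ⊥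
  le_sup_left x y := by
    induction x, y using Quotient.inductionOn₂
    exact Filter.Eventually.of_forall fun _ => le_sup_left
  le_sup_right x y := by
    induction x, y using Quotient.inductionOn₂
    exact Filter.Eventually.of_forall fun _ => le_sup_right
  sup_le x y z := by
    induction x, y using Quotient.inductionOn₂
    induction z using Quotient.inductionOn
    intro h1 h2
    exact Filter.Eventually.mp h1 (Filter.Eventually.mono h2 fun _ h h' => sup_le h' h)
  inf_le_left x y := by
    induction x, y using Quotient.inductionOn₂
    exact Filter.Eventually.of_forall fun _ => inf_le_left
  inf_le_right x y := by
    induction x, y using Quotient.inductionOn₂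
    exact Filter.Eventually.of_forall fun _ => inf_le_right
  le_inf x y z := by
    induction x, y using Quotient.inductionOn₂
    induction z using Quotient.inductionOn
    intro h1 h2
    exact Filter.Eventually.mp h1 (Filter.Eventually.mono h2 fun _ h h' => le_inf h' h)
  le_sup_inf x y z := by
    induction x, y using Quotient.inductionOn₂
    induction z using Quotient.inductionOn
    exact Filter.Eventually.of_forall fun _ => le_sup_inf
  inf_compl_le_bot x := by
    induction x using Quotient.inductionOn
    exact Filter.Eventually.of_forall fun _ => (inf_compl_self (a := _)).le
  top_le_sup_compl x := by
    induction x using Quotient.inductionOn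
    exact Filter.Eventually.of_forall fun _ => sup_compl_eq_top.ge
  le_top x := by
    induction x using Quotient.inductionOn
    exact Filter.Eventually.of_forall fun _ => le_top
  bot_le x := by
    induction x using Quotient.inductionOn
    exact Filter.Eventually.of_forall fun _ => bot_le

end Ultraproduct

/-- The cardinality of the ultraproduct `∏ c_i / D` of a family of cardinals. -/
noncomputable def cardinalUltraproduct {I : Type u} (D : Ultrafilter I)
    (c : I → Cardinal.{u}) : Cardinal.{u} :=
  #((D : Filter I).Product fun i => (c i).out)

/-! View the `f α` as branches of a tree. For a set `A` of levels and signs `G`, the generator of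
`β` contains `β` and the branches leaving it at a level of `A` on the side prescribed by the sign.
`B_ε` is generated by these sets for a set `A_ε` of levels, the `A_ε` being pairwise disjoint.

Each `B_ε` is small because among `lam` distinct elements some later one lies below an earlier one
(`SignSystem.exists_subset`). By pigeonhole all elements may be assumed to be given by one truth
table applied to tuples through the same nodes. By true cofinality two of the tuples split at a
common level of a prescribed positive set, every differing coordinate moving right
(`exists_split_pair`). If the signs at that level match the monotonicity of the truth table in each
coordinate, the combination shrinks (`truthTableSet_anti`). Such signs exist because `κ` disjoint
positive sets and an independent family realize every finite pattern on nodes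
(`exists_signSystems`).

The ultraproduct is large because distinct `β`, `γ` split at a single level, which lies in at most
one `A_ε`. Hence `β` belongs to the generator of `γ` for at most one `ε`, and the diagonal
generators are ideal-independent (`spread_range_gen`). The cardinal inequalities follow from `μ ^ θ
= μ`. -/

/-! ### Sets determined by the first splitting level -/

section Splitting

variable {L : Type*} {I : Type*} [LinearOrder I] {X : I → Type*}

/-- Two members of a family of functions agree strictly below `i`. -/
def AgreeBelow (f : L → ∀ i, X i) (i : I) (α β : L) : Prop := ∀ j < i, f α j = f β j

variable {f : L → ∀ i, X i}

theorem AgreeBelow.symm {i : I} {α β : L} (h : AgreeBelow f i α β) : AgreeBelow f i β α :=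
  fun j hj => (h j hj).symm

theorem AgreeBelow.trans {i : I} {α β γ : L} (h : AgreeBelow f i α β) (h' : AgreeBelow f i β γ) :
    AgreeBelow f i α γ :=
  fun j hj => (h j hj).trans (h' j hj)

theorem AgreeBelow.mono {i j : I} {α β : L} (h : AgreeBelow f i α β) (hj : j ≤ i) :
    AgreeBelow f j α β :=
  fun k hk => h k (hk.trans_le hj)

theorem AgreeBelow.split_unique {i j : I} {α β : L} (hi : AgreeBelow f i α β)
    (hi' : f α i ≠ f β i) (hj : AgreeBelow f j α β) (hj' : f α j ≠ f β j) : i = j := by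
  rcases lt_trichotomy i j with h | h | h
  · exact absurd (hj i h) hi'
  · exact h
  · exact absurd (hi j h) hj'

variable [∀ i, LinearOrder (X i)]

/-- The set of all `α` that are equal to `β`, or split from `β` at a level `i ∈ A`, to the right
of `β` if `G i α` holds and to the left otherwise. -/
def splitSet (f : L → ∀ i, X i) (A : Set I) (G : I → L → Prop) (β : L) : Set L :=
  {α | α = β ∨ ∃ i ∈ A, AgreeBelow f i α β ∧ f α i ≠ f β i ∧ (f β i < f α i ↔ G i α)}

variable {A : Set I} {G : I → L → Prop}

theorem self_mem_splitSet (β : L) : β ∈ splitSet f A G β := Or.inl rfl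

theorem mem_splitSet_of_split {i : I} {α β : L} (hi : i ∈ A) (h : AgreeBelow f i α β)
    (hne : f α i ≠ f β i) : α ∈ splitSet f A G β ↔ (f β i < f α i ↔ G i α) := by
  constructor
  · rintro (rfl | ⟨j, _, hj, hj', hG⟩)
    · exact absurd rfl hne
    · obtain rfl := h.split_unique hne hj hj'
      exact hG
  · exact fun hG => Or.inr ⟨i, hi, h, hne, hG⟩

/-- At their splitting level `β` and `γ` have the same sign but lie on opposite sides of each other,
so they cannot each belong to the set of the other. -/
theorem splitSet_injective (hG : ∀ i ∈ A, ∀ α β, AgreeBelow f i α β → (G i α ↔ G i β)) :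
    Function.Injective (splitSet f A G) := by
  intro β γ h
  by_contra hne
  have h1 : β ∈ splitSet f A G γ := h ▸ self_mem_splitSet β
  have h2 : γ ∈ splitSet f A G β := h ▸ self_mem_splitSet γ
  obtain h1 | ⟨i, hi, ha, hs, hg⟩ := h1
  · exact hne h1
  rw [mem_splitSet_of_split hi ha.symm hs.symm, ← hG i hi β γ ha, ← hg] at h2
  rcases lt_or_gt_of_ne hs with h3 | h3
  · exact h3.not_gt (h2.1 h3)
  · exact h3.not_gt (h2.2 h3)

/-- If `α` has left `β` below `i`, membership was decided at that earlier level, so only the part of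
`α` below `i` matters. -/
theorem mem_splitSet_imp_left (hG : ∀ i ∈ A, ∀ α β, AgreeBelow f i α β → (G i α ↔ G i β))
    {i : I} {α α' β : L} (h : AgreeBelow f i α α') (hn : ¬ AgreeBelow f i α β)
    (hm : α ∈ splitSet f A G β) : α' ∈ splitSet f A G β := by
  obtain rfl | ⟨k, hk, ha, hs, hg⟩ := hm
  · exact absurd (fun _ _ => rfl) hn
  have hki : k < i := lt_of_not_ge fun hik => hn (ha.mono hik)
  have ha' := h.mono hki.le
  refine Or.inr ⟨k, hk, ha'.symm.trans ha, ?_, ?_⟩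
  · rwa [← h k hki]
  · rw [← h k hki, ← hG k hk α α' ha', hg]

theorem mem_splitSet_congr_left (hG : ∀ i ∈ A, ∀ α β, AgreeBelow f i α β → (G i α ↔ G i β))
    {i : I} {α α' β : L} (h : AgreeBelow f i α α') (hn : ¬ AgreeBelow f i α β) :
    α ∈ splitSet f A G β ↔ α' ∈ splitSet f A G β :=
  ⟨mem_splitSet_imp_left hG h hn,
    mem_splitSet_imp_left hG h.symm fun h' => hn (h.trans h')⟩

theorem mem_splitSet_imp_right {i : I} {α β β' : L} (h : AgreeBelow f i β β')
    (hn : ¬ AgreeBelow f i α β) (hm : α ∈ splitSet f A G β) : α ∈ splitSet f A G β' := by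
  obtain rfl | ⟨k, hk, ha, hs, hg⟩ := hm
  · exact absurd (fun _ _ => rfl) hn
  have hki : k < i := lt_of_not_ge fun hik => hn (ha.mono hik)
  refine Or.inr ⟨k, hk, ha.trans (h.mono hki.le), ?_, ?_⟩
  · rwa [← h k hki]
  · rwa [← h k hki]

theorem mem_splitSet_congr_right {i : I} {α β β' : L} (h : AgreeBelow f i β β')
    (hn : ¬ AgreeBelow f i α β) : α ∈ splitSet f A G β ↔ α ∈ splitSet f A G β' :=
  ⟨mem_splitSet_imp_right h hn, mem_splitSet_imp_right h.symm fun h' => hn (h'.trans h.symm)⟩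

/-- The Boolean combination of a tuple of sets with truth table `T`. -/
def truthTableSet {L : Type*} {n : ℕ} (T : Set (Fin n → Prop)) (Y : Fin n → Set L) : Set L :=
  {α | (fun m => α ∈ Y m) ∈ T}

/-- The sign that makes `T`, as a function of its `l`-th coordinate, monotone. -/
def truthTableSign {n : ℕ} (T : Set (Fin n → Prop)) (E : Fin n → Prop) (l : Fin n) : Prop :=
  Function.update E l False ∈ T → Function.update E l True ∈ T

/-- Only an `α` passing through the node of some `β l` at level `i` can notice the change, and only
in coordinate `l`, since the nodes are distinct. Moving `β l` to the right shrinks its set within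
the node if the sign is positive and enlarges it if negative; the sign is chosen so that `T`
responds in the same way in both cases. -/
theorem truthTableSet_anti (hG : ∀ i ∈ A, ∀ α β, AgreeBelow f i α β → (G i α ↔ G i β))
    {n : ℕ} (T : Set (Fin n → Prop)) (β β' : Fin n → L) {i : I} (hi : i ∈ A)
    (hag : ∀ l, AgreeBelow f i (β l) (β' l))
    (hlt : ∀ l, β l = β' l ∨ f (β l) i < f (β' l) i)
    (hd : ∀ l m, l ≠ m → ¬ AgreeBelow f i (β l) (β m))
    (hsign : ∀ l, G i (β l) ↔ truthTableSign T (fun m => β l ∈ splitSet f A G (β m)) l) :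
    truthTableSet T (fun m => splitSet f A G (β' m)) ⊆
      truthTableSet T (fun m => splitSet f A G (β m)) := by
  intro α hα
  simp only [truthTableSet, Set.mem_ofPred_eq] at hα ⊢
  by_cases hl : ∃ l, AgreeBelow f i α (β l)
  · obtain ⟨l, hl⟩ := hl
    -- Outside coordinate `l`, the memberships of `α` are those of `β l` itself, so the relevant row
    -- of the truth table is fixed in advance.
    set E : Fin n → Prop := fun m => β l ∈ splitSet f A G (β m) with hE
    have hnm : ∀ m, m ≠ l → ¬ AgreeBelow f i α (β m) := fun m hm h =>
      hd l m hm.symm (hl.symm.trans h)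
    have e1 : (fun m => α ∈ splitSet f A G (β m)) =
        Function.update E l (α ∈ splitSet f A G (β l)) := by
      funext m
      by_cases hm : m = l
      · subst hm; simp
      · rw [Function.update_of_ne hm]
        exact propext (mem_splitSet_congr_left hG hl (hnm m hm))
    have e2 : (fun m => α ∈ splitSet f A G (β' m)) =
        Function.update E l (α ∈ splitSet f A G (β' l)) := by
      funext m
      by_cases hm : m = l
      · subst hm; simp
      · rw [Function.update_of_ne hm, ← congrFun (e1) m |>.trans (Function.update_of_ne hm _ _)]
        exact propext (mem_splitSet_congr_right (hag m) (hnm m hm)).symm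
    rw [e2] at hα
    rw [e1]
    rcases hlt l with h | h
    · rwa [h]
    have hGα : G i α ↔ truthTableSign T E l := (hG i hi _ _ hl).trans (hsign l)
    have key : (truthTableSign T E l ∧
          (α ∈ splitSet f A G (β' l) → α ∈ splitSet f A G (β l))) ∨
        (¬ truthTableSign T E l ∧
          (α ∈ splitSet f A G (β l) → α ∈ splitSet f A G (β' l))) := by
      by_cases hs : truthTableSign T E l
      · refine Or.inl ⟨hs, fun h' => ?_⟩
        have hle : f (β' l) i ≤ f α i := by
          by_contra hlt'
          rw [mem_splitSet_of_split hi (hl.trans (hag l)) (ne_of_lt (not_le.1 hlt')), hGα] at h'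
          exact hlt' (h'.2 hs).le
        have hlt' := h.trans_le hle
        rw [mem_splitSet_of_split hi hl hlt'.ne', hGα]
        exact iff_of_true hlt' hs
      · refine Or.inr ⟨hs, fun h' => ?_⟩
        have hle : f α i ≤ f (β l) i := by
          by_contra hlt'
          rw [mem_splitSet_of_split hi hl (ne_of_gt (not_le.1 hlt')), hGα] at h'
          exact hs (h'.1 (not_le.1 hlt'))
        have hlt' := hle.trans_lt h
        rw [mem_splitSet_of_split hi (hl.trans (hag l)) hlt'.ne, hGα]
        exact iff_of_false hlt'.not_gt hs
    unfold truthTableSign at key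
    by_cases h1 : α ∈ splitSet f A G (β l) <;> by_cases h2 : α ∈ splitSet f A G (β' l) <;>
      simp only [h1, h2] at hα key ⊢ <;> tauto
  · push Not at hl
    have : (fun m => α ∈ splitSet f A G (β m)) = fun m => α ∈ splitSet f A G (β' m) :=
      funext fun m => propext (mem_splitSet_congr_right (hag m) (hl m))
    rwa [this]

end Splitting

/-! ### The algebra generated by a family of sets -/

section Generated

variable {L K : Type*}

/-- The Boolean algebra generated by a family of sets: its members are the sets that are determined
by finitely many members of the family. -/
def generatedAlgebra (Y : K → Set L) : BooleanSubalgebra (Set L) where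
  carrier := {S | ∃ F : Finset K, ∀ α α', (∀ β ∈ F, α ∈ Y β ↔ α' ∈ Y β) → (α ∈ S → α' ∈ S)}
  supClosed' := by
    classical
    rintro S ⟨F, hF⟩ S' ⟨F', hF'⟩
    refine ⟨F ∪ F', fun α α' h => ?_⟩
    rintro (hS | hS)
    · exact Or.inl (hF α α' (fun β hβ => h β (Finset.mem_union_left _ hβ)) hS)
    · exact Or.inr (hF' α α' (fun β hβ => h β (Finset.mem_union_right _ hβ)) hS)
  infClosed' := by
    classical
    rintro S ⟨F, hF⟩ S' ⟨F', hF'⟩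
    refine ⟨F ∪ F', fun α α' h => ?_⟩
    rintro ⟨hS, hS'⟩
    exact ⟨hF α α' (fun β hβ => h β (Finset.mem_union_left _ hβ)) hS,
      hF' α α' (fun β hβ => h β (Finset.mem_union_right _ hβ)) hS'⟩
  compl_mem' := by
    rintro S ⟨F, hF⟩
    exact ⟨F, fun α α' h hS hS' => hS (hF α' α (fun β hβ => (h β hβ).symm) hS')⟩
  bot_mem' := ⟨∅, fun _ _ _ h => h⟩

theorem mem_generatedAlgebra (Y : K → Set L) (β : K) : Y β ∈ generatedAlgebra Y :=
  ⟨{β}, fun _ _ h => (h β (Finset.mem_singleton_self β)).1⟩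

theorem exists_truthTableSet {Y : K → Set L} {S : Set L} (hS : S ∈ generatedAlgebra Y) :
    ∃ (n : ℕ) (β : Fin n → K) (T : Set (Fin n → Prop)), Function.Injective β ∧
      S = truthTableSet T fun m => Y (β m) := by
  obtain ⟨F, hF⟩ := hS
  refine ⟨F.card, fun m => F.equivFin.symm m,
    {w | ∃ α ∈ S, w = fun m => α ∈ Y (F.equivFin.symm m)},
    Subtype.val_injective.comp F.equivFin.symm.injective, ?_⟩
  ext α
  constructor
  · exact fun hα => ⟨α, hα, rfl⟩
  · rintro ⟨α', hα', h⟩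
    refine hF α' α (fun β hβ => ?_) hα'
    have := congrFun h (F.equivFin ⟨β, hβ⟩)
    simpa using this.symm

end Generated

/-! ### Combinatorics of regular cardinals -/

theorem exists_strict_bound {c : Cardinal.{u}} (hc : c.IsRegular) (s : Set c.ord.ToType)
    (hs : #s < c) : ∃ b, ∀ x ∈ s, x < b := by
  have h : ¬ IsCofinal s := fun h => by
    have := Order.cof_le h
    rw [Ordinal.cof_toType, hc.cof_ord] at this
    exact this.not_gt hs
  simpa [IsCofinal] using h

theorem mk_finFun_lt {α : Type u} {c : Cardinal.{u}} (hc : ℵ₀ ≤ c) (n : ℕ) (h : #α < c) :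
    #(Fin n → α) < c := by
  have e : #(Fin n → α) = #α ^ n := by simp
  rw [e]
  rcases lt_or_ge #α ℵ₀ with h' | h'
  · exact (power_lt_aleph0 h' (natCast_lt_aleph0)).trans_le hc
  · exact (power_nat_le h').trans_lt h

/-- Take `F` minimal such that the coordinates outside it are constant on a large set; a large fibre
over a coordinate in `F` would contradict minimality. -/
theorem exists_constant_off {M : Type u} {lam : Cardinal.{u}} {n : ℕ} (Ξ : Set M)
    (hΞ : lam ≤ #Ξ) (β : M → Fin n → M) :
    ∃ (F : Finset (Fin n)), ∃ Ξ' ⊆ Ξ, lam ≤ #Ξ' ∧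
      (∀ l ∉ F, ∀ ξ ∈ Ξ', ∀ ξ' ∈ Ξ', β ξ l = β ξ' l) ∧
      ∀ l ∈ F, ∀ γ, #{ξ ∈ Ξ' | β ξ l = γ} < lam := by
  classical
  let P : Finset (Fin n) → Prop := fun F => ∃ Ξ' ⊆ Ξ, lam ≤ #Ξ' ∧
      ∀ l ∉ F, ∀ ξ ∈ Ξ', ∀ ξ' ∈ Ξ', β ξ l = β ξ' l
  have hP : ∃ F, P F := ⟨Finset.univ, Ξ, subset_rfl, hΞ, fun l hl => absurd (Finset.mem_univ l) hl⟩
  obtain ⟨F, hF⟩ := exists_minimal_of_wellFoundedLT P hP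
  obtain ⟨Ξ', hsub, hcard, hconst⟩ := hF.prop
  refine ⟨F, Ξ', hsub, hcard, hconst, fun l hl γ => ?_⟩
  by_contra hge
  have hPe : P (F.erase l) := by
    refine ⟨{ξ ∈ Ξ' | β ξ l = γ}, fun ξ hξ => hsub hξ.1, not_lt.1 hge, ?_⟩
    intro m hm ξ hξ ξ' hξ'
    by_cases hml : m = l
    · subst hml; exact hξ.2.trans hξ'.2.symm
    · exact hconst m (fun h => hm (Finset.mem_erase.2 ⟨hml, h⟩)) ξ hξ.1 ξ' hξ'.1
  exact Finset.notMem_erase l F (hF.le_of_le hPe (Finset.erase_subset l F) hl)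

theorem exists_coordinates_ge {lam : Cardinal.{u}} (hlam : lam.IsRegular) {n : ℕ}
    {Ξ : Set lam.ord.ToType} (hΞ : lam ≤ #Ξ) {β : lam.ord.ToType → Fin n → lam.ord.ToType}
    {F : Finset (Fin n)} (hF : ∀ l ∈ F, ∀ γ, #{ξ ∈ Ξ | β ξ l = γ} < lam)
    (α : lam.ord.ToType) : ∃ ξ ∈ Ξ, ∀ l ∈ F, α ≤ β ξ l := by
  by_contra! h
  have hcov : Ξ ⊆ ⋃ p : F × Set.Iio α, {ξ ∈ Ξ | β ξ p.1 = p.2} := by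
    intro ξ hξ
    obtain ⟨l, hl, hlt⟩ := h ξ hξ
    exact Set.mem_iUnion.2 ⟨(⟨l, hl⟩, ⟨β ξ l, hlt⟩), hξ, rfl⟩
  refine (hΞ.trans (mk_le_mk_of_subset hcov)).not_gt ?_
  rw [card_iUnion_lt_iff_forall_of_isRegular hlam]
  · exact fun p => hF p.1 p.1.2 p.2
  · rw [mk_prod]
    simp only [lift_uzero]
    refine mul_lt_of_lt hlam.aleph0_le ?_ ((mk_Iio_lt α (by simp)).trans_eq (by simp))
    have : Cardinal.lift.{u} #F < ℵ₀ := by simp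
    exact this.trans_le hlam.aleph0_le

/-! ### Consequences of the definition of a system -/

namespace LambdaSystem

variable {lam : Cardinal.{u}} (S : LambdaSystem lam)

theorem nonempty_index : Nonempty S.δ.ToType := by
  rw [Ordinal.nonempty_toType_iff]
  exact S.isSuccLimit.ne_bot

theorem mem_of_subset {s t : Set S.δ.ToType} (h : s ⊆ t) (ht : t ∈ S.J) : s ∈ S.J :=
  S.J.lower h ht

theorem union_mem {s t : Set S.δ.ToType} (hs : s ∈ S.J) (ht : t ∈ S.J) : s ∪ t ∈ S.J :=
  Order.Ideal.sup_mem hs ht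

theorem biUnion_mem {ι : Type*} (F : Finset ι) {s : ι → Set S.δ.ToType}
    (hs : ∀ l ∈ F, s l ∈ S.J) : (⋃ l ∈ F, s l) ∈ S.J := by
  classical
  induction F using Finset.induction_on with
  | empty =>
    obtain ⟨i⟩ := S.nonempty_index
    simpa using S.bounded_mem ∅ ⟨i, by simp⟩
  | insert a F ha ih =>
    rw [Finset.set_biUnion_insert]
    exact S.union_mem (hs a (Finset.mem_insert_self a F))
      (ih fun l hl => hs l (Finset.mem_insert_of_mem hl))

theorem le_mod {α β : lam.ord.ToType} (h : α ≤ β) : {i | ¬ S.f α i ≤ S.f β i} ∈ S.J := by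
  rcases h.eq_or_lt with rfl | h
  · simpa using S.biUnion_mem (∅ : Finset ℕ) (s := fun _ => ∅) (by simp)
  · exact S.mem_of_subset (fun i hi hlt => hi (le_of_lt hlt)) (S.increasing α β h)

instance : NoMaxOrder S.δ.ToType :=
  Ordinal.isSuccPrelimit_type_lt_iff.1 (by
    rw [Ordinal.type_toType]; exact S.isSuccLimit.isSuccPrelimit)

/-- Otherwise `lam` many functions are bounded at every coordinate from `i` on, and the bounding
function contradicts cofinality. -/
theorem lamSeq_le (i : S.δ.ToType) : S.lamSeq i ≤ lam := by
  by_contra! hlt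
  have hb : ∀ j, ∃ b : (S.lamSeq j).ord.ToType, i ≤ j → ∀ α, S.f α j < b := by
    intro j
    by_cases hij : i ≤ j
    · obtain ⟨b, hb⟩ := exists_strict_bound (S.isRegular j) (Set.range fun α => S.f α j)
        (by
          refine mk_range_le.trans_lt ?_
          simpa using hlt.trans_le (S.strictMono.monotone hij))
      exact ⟨b, fun _ α => hb _ ⟨α, rfl⟩⟩
    · have : Nonempty (S.lamSeq j).ord.ToType := by
        rw [Ordinal.nonempty_toType_iff]
        exact (S.isRegular j).ord_pos.ne'
      exact ⟨Classical.arbitrary _, fun h => absurd h hij⟩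
  choose b hb using hb
  obtain ⟨α, hα⟩ := S.cofinal b
  refine S.univ_notMem (S.mem_of_subset ?_
    (S.union_mem hα (S.bounded_mem (Set.Iio i) bddAbove_Iio)))
  intro j _
  rcases lt_or_ge j i with h | h
  · exact Or.inr h
  · exact Or.inl (hb j h α).not_ge

theorem lamSeq_lt (i : S.δ.ToType) : S.lamSeq i < lam := by
  obtain ⟨j, hj⟩ := exists_gt i
  exact (S.strictMono hj).trans_le (S.lamSeq_le j)

theorem aleph0_lt (S : LambdaSystem lam) : ℵ₀ < lam := by
  obtain ⟨i⟩ := S.nonempty_index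
  exact (S.isRegular i).aleph0_le.trans_lt (S.lamSeq_lt i)

/-- Given `lam` many different finite tuples of indices, and a positive set `A` of levels, two of
the tuples first split at a common level in `A`, in the same direction in all coordinates in which
they differ. -/
theorem exists_split_pair (hlam : lam.IsRegular) {Ξ : Set lam.ord.ToType} (hΞ : lam ≤ #Ξ) {n : ℕ}
    {β : lam.ord.ToType → Fin n → lam.ord.ToType} (hβ : Set.InjOn β Ξ)
    {A : Set S.δ.ToType} (hA : A ∉ S.J) :
    ∃ i ∈ A, ∃ ξ ∈ Ξ, ∃ ξ' ∈ Ξ, ξ < ξ' ∧ ∀ l, AgreeBelow S.f i (β ξ l) (β ξ' l) ∧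
      (β ξ l = β ξ' l ∨ S.f (β ξ l) i < S.f (β ξ' l) i) := by
  obtain ⟨F, Ξ', hsub, hcard, hconst, hfib⟩ := exists_constant_off Ξ hΞ β
  by_contra! hno
  have hFne : F.Nonempty := by
    by_contra hF
    rw [Finset.not_nonempty_iff_eq_empty] at hF
    subst hF
    have h1 : 1 < #Ξ' := one_lt_aleph0.trans_le (hlam.aleph0_le.trans hcard)
    obtain ⟨ξ, ξ', hne⟩ := (one_lt_iff_nontrivial.1 h1).exists_pair_ne
    exact hne (Subtype.ext (hβ (hsub ξ.2) (hsub ξ'.2)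
      (funext fun l => hconst l (by simp) _ ξ.2 _ ξ'.2)))
  -- the node of length `i` of a tuple
  let node : ∀ i, lam.ord.ToType → Fin n → restrictions S.f i :=
    fun i ξ l => ⟨_, ⟨β ξ l, rfl⟩⟩
  have hnode : ∀ i ξ ξ', node i ξ = node i ξ' → ∀ l, AgreeBelow S.f i (β ξ l) (β ξ' l) :=
    fun i ξ ξ' h l j hj => congrFun (congrArg Subtype.val (congrFun h l)) ⟨j, hj⟩
  -- Each node tuple is represented by the least index through it. There are fewer than `lamSeq i`
  -- representatives, so `b` can exceed all their values at `i`; any later index through the same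
  -- node fails to move right in some coordinate, and is below `b` there.
  have hbound : ∀ i, ∃ b, i ∈ A → ∀ ξ ∈ Ξ', ∃ l ∈ F, S.f (β ξ l) i < b := by
    intro i
    let first : Set.range (fun ξ : Ξ' => node i ξ) → lam.ord.ToType := fun s =>
      WellFounded.min (wellFounded_lt) {ξ | ξ ∈ Ξ' ∧ node i ξ = s}
        (by obtain ⟨ξ, hξ⟩ := s.2; exact ⟨ξ, ξ.2, hξ⟩)
    have hfirst : ∀ s, first s ∈ Ξ' ∧ node i (first s) = s := fun s =>
      WellFounded.min_mem (wellFounded_lt) {ξ | ξ ∈ Ξ' ∧ node i ξ = s} _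
    have hcardR : #(Set.range fun p : Set.range (fun ξ : Ξ' => node i ξ) × Fin n =>
        S.f (β (first p.1) p.2) i) < S.lamSeq i := by
      refine mk_range_le.trans_lt ?_
      rw [mk_prod]
      refine mul_lt_of_lt (S.isRegular i).aleph0_le ?_ ?_
      · rw [lift_uzero]
        exact (mk_set_le _).trans_lt
          (mk_finFun_lt (S.isRegular i).aleph0_le n (S.card_restrictions_lt i))
      · refine lt_of_lt_of_le ?_ (S.isRegular i).aleph0_le
        simp
    obtain ⟨b, hb⟩ := exists_strict_bound (S.isRegular i) _ hcardR
    refine ⟨b, fun hiA ξ hξ => ?_⟩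
    let s : Set.range (fun ξ : Ξ' => node i ξ) := ⟨node i ξ, ⟨ξ, hξ⟩, rfl⟩
    have hle : first s ≤ ξ := WellFounded.min_le (wellFounded_lt)
      (s := {ξ | ξ ∈ Ξ' ∧ node i ξ = s}) ⟨hξ, rfl⟩
    rcases hle.eq_or_lt with heq | hlt
    · obtain ⟨l, hl⟩ := hFne
      refine ⟨l, hl, ?_⟩
      rw [← heq]
      exact hb _ ⟨(s, l), rfl⟩
    · have hag := hnode i (first s) ξ (hfirst s).2
      obtain ⟨l, hl⟩ := hno i hiA _ (hsub (hfirst s).1) _ (hsub hξ) hlt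
      obtain ⟨hl1, hl2⟩ := hl (hag l)
      refine ⟨l, ?_, hl2.trans_lt (hb _ ⟨(s, l), rfl⟩)⟩
      by_contra hlF
      exact hl1 (hconst l hlF _ (hfirst s).1 _ hξ)
  choose b hb using hbound
  obtain ⟨α, hα⟩ := S.cofinal b
  -- All nonconstant coordinates of this tuple dominate `b` modulo `J`, against the bound just found
  -- on the positive set `A`.
  obtain ⟨ξ, hξ, hge⟩ := exists_coordinates_ge hlam hcard hfib α
  refine hA (S.mem_of_subset ?_ (S.union_mem hα
    (S.biUnion_mem F (s := fun l => {i | ¬ S.f α i ≤ S.f (β ξ l) i})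
      fun l hl => S.le_mod (hge l hl))))
  intro i hi
  by_contra hmem
  simp only [Set.mem_union, Set.mem_ofPred_eq, Set.mem_iUnion, not_or, not_not, not_exists] at hmem
  obtain ⟨l, hl, hlt⟩ := hb i hi ξ hξ
  exact (hlt.trans_le (hmem.1.trans (hmem.2 l hl))).false

/-- A family of sets of levels and of signs that realizes all patterns of signs on finite sets of
nodes at positively many levels. -/
structure SignSystem where
  A : Set S.δ.ToType
  G : S.δ.ToType → lam.ord.ToType → Prop
  sign_congr : ∀ i ∈ A, ∀ α β, AgreeBelow S.f i α β → (G i α ↔ G i β)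
  exists_level : ∀ j : S.δ.ToType, ∃ k ≥ j, ∀ (n : ℕ) (t : Fin n → restrictions S.f k),
    Function.Injective t → ∀ r : Fin n → Prop, ∃ A' ⊆ A, A' ∉ S.J ∧ A' ⊆ Set.Ioi k ∧
      ∀ l, ∀ α, (fun i : Set.Iio k => S.f α i.1) = (t l).1 →
        ∀ i ∈ A', G i α ↔ r l

end LambdaSystem

/-! ### Independent families -/

/-- The members of the independent family of functions on subsets of `K` that is indexed by finite
sets and finite sets of finite sets. -/
def finsetTrace {K : Type*} (q : Finset K × Finset (Finset K)) (Y : Set K) : Prop :=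
  ∃ F ∈ q.2, ∀ x ∈ q.1, x ∈ F ↔ x ∈ Y

/-- A finite set `F₀` separates the `t l`; the accepted traces on it are those of the `t l` with `r
l`. -/
theorem exists_finsetTrace {K : Type*} {n : ℕ} (t : Fin n → Set K) (ht : Function.Injective t)
    (r : Fin n → Prop) : ∃ q, ∀ l, finsetTrace q (t l) ↔ r l := by
  classical
  have hx : ∀ p : Fin n × Fin n, ∃ F : Finset K, p.1 ≠ p.2 → ∃ x ∈ F, ¬ (x ∈ t p.1 ↔ x ∈ t p.2) := by
    rintro ⟨l, m⟩
    by_cases h : l = m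
    · exact ⟨∅, fun h' => absurd h h'⟩
    · obtain ⟨x, hx⟩ : ∃ x, ¬ (x ∈ t l ↔ x ∈ t m) := by
        by_contra! h'
        exact h (ht (Set.ext h'))
      exact ⟨{x}, fun _ => ⟨x, Finset.mem_singleton_self x, hx⟩⟩
  choose F hF using hx
  set F₀ := Finset.univ.biUnion F with hF₀
  refine ⟨(F₀, (Finset.univ.filter r).image fun l => F₀.filter (· ∈ t l)), fun l => ?_⟩
  constructor
  · rintro ⟨_, hmem, hx⟩
    obtain ⟨m, hm, rfl⟩ := Finset.mem_image.1 hmem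
    have hrm : r m := (Finset.mem_filter.1 hm).2
    by_contra hl
    have hne : l ≠ m := fun h => hl (h ▸ hrm)
    obtain ⟨x, hxF, hxn⟩ := hF (l, m) hne
    have hx0 : x ∈ F₀ := Finset.mem_biUnion.2 ⟨_, Finset.mem_univ _, hxF⟩
    have := hx x hx0
    simp only [Finset.mem_filter, hx0, true_and] at this
    exact hxn this.symm
  · intro hr
    refine ⟨_, Finset.mem_image.2 ⟨l, Finset.mem_filter.2 ⟨Finset.mem_univ l, hr⟩, rfl⟩, ?_⟩
    intro x hx
    simp [show x ∈ F₀ from hx]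

/-! ### Descents in long sequences of elements of the algebra of a sign system -/

namespace LambdaSystem.SignSystem

variable {lam : Cardinal.{u}} {S : LambdaSystem lam} (Q : S.SignSystem)

theorem sets_injective : Function.Injective (splitSet S.f Q.A Q.G) :=
  splitSet_injective Q.sign_congr

theorem exists_not_agreeBelow {n : ℕ} {β : Fin n → lam.ord.ToType} (hβ : Function.Injective β) :
    ∃ k : S.δ.ToType, ∀ l m, l ≠ m → ¬ AgreeBelow S.f k (β l) (β m) := by
  have h : ∀ p : Fin n × Fin n, ∃ k : S.δ.ToType, p.1 ≠ p.2 →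
      ¬ AgreeBelow S.f k (β p.1) (β p.2) := by
    rintro ⟨l, m⟩
    by_cases hlm : l = m
    · obtain ⟨k⟩ := S.nonempty_index
      exact ⟨k, fun h => absurd hlm h⟩
    · obtain ⟨i, hi⟩ : ∃ i, S.f (β l) i ≠ S.f (β m) i := by
        by_contra! h
        exact hlm (hβ (S.injective (funext h)))
      obtain ⟨k, hk⟩ := exists_gt i
      exact ⟨k, fun _ h => hi (h i hk)⟩
  choose k hk using h
  have := S.nonempty_index
  obtain ⟨k₀, hk₀⟩ := (Finset.univ.image k).exists_le
  refine ⟨k₀, fun l m hlm h => hk (l, m) hlm (h.mono ?_)⟩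
  exact hk₀ _ (Finset.mem_image_of_mem k (Finset.mem_univ _))

theorem exists_subset (hlam : lam.IsRegular) (p : lam.ord.ToType → Set lam.ord.ToType)
    (hp : Function.Injective p) (hmem : ∀ ξ, p ξ ∈ generatedAlgebra (splitSet S.f Q.A Q.G)) :
    ∃ ξ ξ', ξ < ξ' ∧ p ξ' ⊆ p ξ := by
  classical
  choose lvl hlvl using Q.exists_level
  have hrep : ∀ ξ, ∃ d : ℕ × S.δ.ToType, ∃ (β : Fin d.1 → lam.ord.ToType)
      (T : Set (Fin d.1 → Prop)), (∀ l m, l ≠ m → ¬ AgreeBelow S.f (lvl d.2) (β l) (β m)) ∧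
      p ξ = truthTableSet T fun m => splitSet S.f Q.A Q.G (β m) := by
    intro ξ
    obtain ⟨n, β, T, hβ, hT⟩ := exists_truthTableSet (hmem ξ)
    obtain ⟨k, hk⟩ := exists_not_agreeBelow (S := S) hβ
    exact ⟨(n, k), β, T, fun l m hlm h => hk l m hlm (h.mono (hlvl k).1), hT⟩
  choose d hd using hrep
  have hcard : #(ℕ × S.δ.ToType) < lam.ord.cof := by
    rw [hlam.cof_ord, mk_prod]
    refine mul_lt_of_lt hlam.aleph0_le (by simpa using S.aleph0_lt) ?_
    simpa using S.card_lt
  obtain ⟨⟨n, k⟩, hnk⟩ := infinite_pigeonhole_card d lam (by simp) hlam.aleph0_le hcard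
  set Ξ := d ⁻¹' {(n, k)} with hΞ
  have hrep' : ∀ ξ, ∃ (β : Fin n → lam.ord.ToType) (T : Set (Fin n → Prop)), ξ ∈ Ξ →
      (∀ l m, l ≠ m → ¬ AgreeBelow S.f (lvl k) (β l) (β m)) ∧
      p ξ = truthTableSet T fun m => splitSet S.f Q.A Q.G (β m) := by
    intro ξ
    by_cases h : ξ ∈ Ξ
    · have h' : d ξ = (n, k) := h
      have := hd ξ
      rw [h'] at this
      obtain ⟨β, T, h⟩ := this
      exact ⟨β, T, fun _ => h⟩
    · exact ⟨fun _ => ξ, ∅, fun h' => absurd h' h⟩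
  choose β T hβT using hrep'
  obtain ⟨hk, hlev⟩ := hlvl k
  set j := lvl k
  -- The required signs depend on the truth table and on the tuple, so they are fixed by pigeonhole
  -- together with the nodes before the levels are chosen.
  let data : Ξ → Set (Fin n → Prop) × (Fin n → restrictions S.f j) × (Fin n → Prop) :=
    fun ξ => (T ξ, fun l => ⟨_, ⟨β ξ l, rfl⟩⟩,
      fun l => truthTableSign (T ξ) (fun m => β ξ l ∈ splitSet S.f Q.A Q.G (β ξ m)) l)
  have hcard' : #(Set (Fin n → Prop) × (Fin n → restrictions S.f j) × (Fin n → Prop)) <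
      lam.ord.cof := by
    rw [hlam.cof_ord, mk_prod, mk_prod]
    refine mul_lt_of_lt hlam.aleph0_le ?_ ?_
    · exact lt_of_lt_of_le (by simpa using mk_lt_aleph0 (α := Set (Fin n → Prop))) hlam.aleph0_le
    rw [lift_uzero]
    refine mul_lt_of_lt hlam.aleph0_le ?_ ?_
    · simpa using mk_finFun_lt hlam.aleph0_le n ((S.card_restrictions_lt j).trans (S.lamSeq_lt j))
    · exact lt_of_lt_of_le (by simpa using mk_lt_aleph0 (α := Fin n → Prop)) hlam.aleph0_le
  obtain ⟨⟨T₀, t, r⟩, Ξ', hsub, hΞ', hdata⟩ :=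
    infinite_pigeonhole_set data lam hnk hlam.aleph0_le hcard'
  have hT : ∀ ξ ∈ Ξ', T ξ = T₀ := fun ξ hξ => congrArg Prod.fst (hdata hξ)
  have ht : ∀ ξ ∈ Ξ', ∀ l, (fun i : Set.Iio j => S.f (β ξ l) i.1) = (t l).1 := fun ξ hξ l =>
    congrArg Subtype.val (congrFun (congrArg (fun x => x.2.1) (hdata hξ)) l)
  have hr : ∀ ξ ∈ Ξ', ∀ l,
      truthTableSign (T ξ) (fun m => β ξ l ∈ splitSet S.f Q.A Q.G (β ξ m)) l = r l :=
    fun ξ hξ l => congrFun (congrArg (fun x => x.2.2) (hdata hξ)) l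
  have htinj : Function.Injective t := by
    obtain ⟨⟨ξ, hξ⟩⟩ : Nonempty Ξ' := by
      rw [← mk_ne_zero_iff]
      exact (hlam.pos.trans_le hΞ').ne'
    intro l m hlm
    by_contra hne
    refine (hβT ξ (hsub hξ)).1 l m hne fun i hi => ?_
    have := (ht ξ hξ l).trans ((congrArg Subtype.val hlm).trans (ht ξ hξ m).symm)
    exact congrFun this ⟨i, hi⟩
  have hinj : Set.InjOn β Ξ' := by
    intro ξ hξ ξ' hξ' h
    apply hp
    rw [(hβT ξ (hsub hξ)).2, (hβT ξ' (hsub hξ')).2, hT ξ hξ, hT ξ' hξ', h]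
  obtain ⟨A', hA', hpos, hgt, hsign⟩ := hlev n t htinj r
  obtain ⟨i, hi, ξ, hξ, ξ', hξ', hlt, hpair⟩ := S.exists_split_pair hlam hΞ' hinj hpos
  refine ⟨ξ, ξ', hlt, ?_⟩
  rw [(hβT ξ (hsub hξ)).2, (hβT ξ' (hsub hξ')).2, hT ξ' hξ', ← hT ξ hξ]
  refine truthTableSet_anti Q.sign_congr (T ξ) (β ξ) (β ξ') (hA' hi) (fun l => (hpair l).1)
    (fun l => (hpair l).2) (fun l m hlm h => (hβT ξ (hsub hξ)).1 l m hlm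
      (h.mono (le_of_lt (hgt hi)))) fun l => ?_
  rw [hr ξ hξ l]
  exact hsign l _ (ht ξ hξ l) i hi

end LambdaSystem.SignSystem

/-! ### Sign systems from a strong system -/

namespace StrongLambdaSystem

variable {lam κ : Cardinal.{u}}

theorem exists_signSystems (S : StrongLambdaSystem lam κ) {Θ : Type u} (hκ : ℵ₀ ≤ κ)
    (hΘ : #Θ ≤ κ) :
    ∃ Q : Θ → S.SignSystem, Pairwise fun ε ε' => Disjoint (Q ε).A (Q ε').A := by
  classical
  obtain ⟨C, hC, hCcard⟩ := Order.exists_cof_eq S.δ.ToType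
  rw [Ordinal.cof_toType] at hCcard
  let K := κ.ord.ToType
  have hK : #K = κ := by simp [K]
  have : Infinite K := by rw [infinite_iff, hK]; exact hκ
  -- A separate positive set is reserved for each algebra `ε`, level `c` of a cofinal set and trace
  -- condition `q`.
  obtain ⟨φ⟩ : Nonempty (Θ × C × (Finset K × Finset (Finset K)) ↪ K) := by
    rw [← le_def]
    simp only [mk_prod, lift_id, mk_finset_of_infinite, hK]
    refine mul_le_of_le hκ hΘ (mul_le_of_le hκ ?_ (mul_le_of_le hκ le_rfl le_rfl))
    exact hCcard.trans_le S.cof_le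
  have he : ∀ k : S.δ.ToType, Nonempty (restrictions S.f k ↪ Set K) := fun k => by
    rw [← le_def, mk_set, hK]
    exact (S.card_restrictions_lt k).le.trans
      ((le_ciSup (bddAbove_of_small) k).trans S.iSup_le)
  let e := fun k => (he k).some
  -- Cutting off at `c` makes the sign at `i` depend only on a node below `i`, and removes only a
  -- bounded set.
  let D : Θ → C → Finset K × Finset (Finset K) → Set S.δ.ToType :=
    fun ε c q => S.A (φ (ε, c, q)) ∩ Set.Ioi c.1
  have hD : ∀ {ε c q ε' c' q' i}, i ∈ D ε c q → i ∈ D ε' c' q' → (ε, c, q) = (ε', c', q') := by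
    intro ε c q ε' c' q' i h h'
    by_contra hne
    exact Set.disjoint_left.1 (S.A_disjoint fun h => hne (φ.injective h)) h.1 h'.1
  let nd : ∀ k : S.δ.ToType, lam.ord.ToType → restrictions S.f k := fun k α => ⟨_, ⟨α, rfl⟩⟩
  let Q : Θ → S.SignSystem := fun ε =>
    { A := ⋃ c, ⋃ q, D ε c q
      G := fun i α => ∃ c q, i ∈ D ε c q ∧ finsetTrace q (e c.1 (nd c.1 α))
      sign_congr := by
        intro i _ α β h
        have key : ∀ c q, i ∈ D ε c q → nd c.1 α = nd c.1 β := fun c q hi =>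
          Subtype.ext (funext fun j => h j.1 (j.2.trans hi.2))
        constructor
        · rintro ⟨c, q, hi, hq⟩
          exact ⟨c, q, hi, key c q hi ▸ hq⟩
        · rintro ⟨c, q, hi, hq⟩
          exact ⟨c, q, hi, (key c q hi).symm ▸ hq⟩
      exists_level := by
        intro j
        obtain ⟨k, hkC, hk⟩ := hC j
        refine ⟨k, hk, fun n t ht r => ?_⟩
        obtain ⟨q, hq⟩ := exists_finsetTrace (fun l => e k (t l)) ((e k).injective.comp ht) r
        refine ⟨D ε ⟨k, hkC⟩ q, fun i hi => Set.mem_iUnion₂.2 ⟨_, q, hi⟩, ?_,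
          Set.inter_subset_right, ?_⟩
        · intro h
          refine S.A_notMem (φ (ε, ⟨k, hkC⟩, q)) (S.mem_of_subset ?_
            (S.union_mem h (S.bounded_mem (Set.Iic k) bddAbove_Iic)))
          intro i hi
          rcases le_or_gt i k with h | h
          · exact Or.inr h
          · exact Or.inl ⟨hi, h⟩
        · intro l α hα i hi
          have hnd : nd k α = t l := Subtype.ext hα
          rw [← hq l, ← hnd]
          constructor
          · rintro ⟨c', q', hi', hq'⟩
            have := hD hi hi'
            simp only [Prod.mk.injEq, true_and] at this
            obtain ⟨rfl, rfl⟩ := this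
            exact hq'
          · exact fun h => ⟨⟨k, hkC⟩, q, hi, h⟩ }
  refine ⟨Q, fun ε ε' hne => Set.disjoint_left.2 fun i hi hi' => ?_⟩
  obtain ⟨c, q, h⟩ := Set.mem_iUnion₂.1 hi
  obtain ⟨c', q', h'⟩ := Set.mem_iUnion₂.1 hi'
  exact hne (congrArg Prod.fst (hD h h'))

end StrongLambdaSystem

/-! ### Bounds on the invariants -/

section Bounds

variable {B : Type u} [BooleanAlgebra B]

/-- A model of size at least `lam` would contain a copy of `lam` in its well ordering, and the given
descent would reverse that ordering. -/
theorem baInvPlus_theoryHCof_le {lam : Cardinal.{u}}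
    (h : ∀ p : lam.ord.ToType → B, Function.Injective p → ∃ ξ ξ', ξ < ξ' ∧ p ξ' ≤ p ξ) :
    baInvPlus B theoryHCof ≤ lam := by
  refine ciSup_le' ?_
  rintro ⟨P, R, hR, hlt⟩
  rw [Order.succ_le_iff]
  by_contra! hP
  have hle : lam.ord ≤ Ordinal.type (fun x y : P => R x y) := by
    rw [ord_le, Ordinal.card_type]
    exact hP
  rw [← Ordinal.type_toType lam.ord, Ordinal.type_le_iff] at hle
  obtain ⟨g⟩ := hle
  obtain ⟨ξ, ξ', hξ, hle⟩ := h (fun ξ => (g ξ).1) (Subtype.val_injective.comp g.injective)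
  have h1 : R (g ξ) (g ξ') := g.map_rel_iff.2 hξ
  have hne : (g ξ').1 ≠ (g ξ).1 := fun h' => hξ.ne' (g.injective (Subtype.ext h'))
  have h2 : R (g ξ') (g ξ) := hlt _ (g ξ').2 _ (g ξ).2 (lt_of_le_of_ne hle hne)
  exact (hR.toIsWellFounded.wf.asymmetric (a := g ξ) (b := g ξ') h1) h2

theorem succ_mk_le_baInvPlus {T : BATheory.{u}} {P : Set B} {R : B → B → Prop} (h : T B P R) :
    Order.succ #P ≤ baInvPlus B T :=
  le_ciSup (f := fun P : {P : Set B // ∃ R : B → B → Prop, T B P R} => Order.succ #P.1)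
    bddAbove_of_small ⟨P, R, h⟩

theorem mk_le_of_theoryHCof {μ : Cardinal.{u}} (h : baInvPlus B theoryHCof ≤ Order.succ μ)
    {P : Set B} {R : B → B → Prop} (hP : theoryHCof B P R) : #P ≤ μ :=
  Order.succ_le_succ_iff.1 ((succ_mk_le_baInvPlus hP).trans h)

theorem hereditaryCofinality_le {μ : Cardinal.{u}}
    (h : baInvPlus B theoryHCof ≤ Order.succ μ) : hereditaryCofinality B ≤ μ := by
  refine csInf_le' ?_
  intro X
  let R : B → B → Prop := WellOrderingRel
  -- Well order `B` arbitrarily and keep the members of `X` that are not below an earlier member;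
  -- the first member of `X` above a given `x` is always kept.
  have hC : theoryHCof B {x ∈ X | ∀ y ∈ X, R y x → ¬ x ≤ y} R := by
    refine ⟨(Subrel.relEmbedding R _).isWellOrder, fun x hx y hy hxy => ?_⟩
    rcases trichotomous_of R x y with h' | h' | h'
    · exact h'
    · exact absurd h' hxy.ne
    · exact absurd hxy.le (hx.2 y hy.1 h')
  refine ⟨_, fun x hx => hx.1, mk_le_of_theoryHCof h hC, fun x hx => ?_⟩
  have hwf : WellFounded R := IsWellFounded.wf
  have hne : {y | y ∈ X ∧ x ≤ y}.Nonempty := ⟨x, hx, le_rfl⟩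
  refine ⟨hwf.min _ hne, ⟨(hwf.min_mem _ hne).1, fun y hy hR hle => ?_⟩, (hwf.min_mem _ hne).2⟩
  exact hwf.not_lt_min (s := {y | y ∈ X ∧ x ≤ y}) ⟨hy, (hwf.min_mem _ hne).2.trans hle⟩ hR

/-- On an antichain the order condition is vacuous, so any well ordering gives a model. -/
theorem incomparability_le {μ : Cardinal.{u}}
    (h : baInvPlus B theoryHCof ≤ Order.succ μ) : incomparability B ≤ μ := by
  refine ciSup_le' ?_
  rintro ⟨P, _, hP⟩
  refine mk_le_of_theoryHCof (R := WellOrderingRel) h ⟨?_, ?_⟩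
  · exact (Subrel.relEmbedding WellOrderingRel P).isWellOrder
  · exact fun x hx y hy hxy => absurd hxy.le (hP x hx y hy hxy.ne)

theorem le_incomparability {P : Set B} (hP : ∀ x ∈ P, ∀ y ∈ P, x ≠ y → ¬ x ≤ y) :
    #P ≤ incomparability B :=
  le_ciSup (f := fun P : {P : Set B // ∃ R : B → B → Prop, theoryInc B P R} => #P.1)
    bddAbove_of_small ⟨P, fun _ _ => True, hP⟩

/-- The only cofinal subset of an antichain is the antichain itself. -/
theorem le_hereditaryCofinality {P : Set B} (hP : ∀ x ∈ P, ∀ y ∈ P, x ≠ y → ¬ x ≤ y) :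
    #P ≤ hereditaryCofinality B := by
  refine le_csInf ⟨#B, fun X => ⟨X, subset_rfl, mk_set_le X, fun x hx => ⟨x, hx, le_rfl⟩⟩⟩ ?_
  intro c hc
  obtain ⟨C, hCP, hCc, hC⟩ := hc P
  refine (mk_le_mk_of_subset fun x hx => ?_).trans hCc
  obtain ⟨y, hy, hxy⟩ := hC x hx
  by_contra hxC
  exact hP x hx y (hCP hy) (fun h => hxC (h ▸ hy)) hxy

theorem not_le_of_spreadFormula {P : Set B} (hP : spreadFormula 0 P) :
    ∀ x ∈ P, ∀ y ∈ P, x ≠ y → ¬ x ≤ y := by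
  intro x hx y hy hne hle
  refine hP x hx (fun _ => y) (fun _ _ _ => Subsingleton.elim (α := Fin 1) _ _)
    (fun _ => ⟨hy, hne.symm⟩) ?_
  simpa using hle

end Bounds

/-! ### Ultraproducts -/

theorem cardinalUltraproduct_le {I : Type u} (D : Ultrafilter I) {c : I → Cardinal.{u}}
    {μ : Cardinal.{u}} (h : ∀ i, c i ≤ μ) : cardinalUltraproduct D c ≤ μ ^ #I := by
  refine (mk_le_of_surjective (f := fun g : ∀ i, (c i).out => Quotient.mk _ g)
    Quotient.mk_surjective).trans ?_
  rw [mk_pi, ← prod_const']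
  exact prod_le_prod _ _ fun i => by simpa using h i

section Ultraproduct

variable {I : Type v} {l : Filter I} {B : I → Type u}

/-- The class of a family in the product modulo a filter. -/
def Filter.Product.ofFamily (l : Filter I) (g : ∀ i, B i) : l.Product B := Quotient.mk _ g

theorem Filter.Product.ofFamily_eq {g h : ∀ i, B i} :
    ofFamily l g = ofFamily l h ↔ ∀ᶠ i in l, g i = h i := Quotient.eq

variable [∀ i, BooleanAlgebra (B i)]

theorem Filter.Product.ofFamily_le {g h : ∀ i, B i} :
    ofFamily l g ≤ ofFamily l h ↔ ∀ᶠ i in l, g i ≤ h i := Iff.rfl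

theorem Filter.Product.sup_ofFamily {ι : Type*} (F : Finset ι) (g : ι → ∀ i, B i) :
    F.sup (fun j => ofFamily l (g j)) = ofFamily l fun i => F.sup fun j => g j i := by
  classical
  induction F using Finset.induction_on with
  | empty => rfl
  | insert a F _ ih =>
    rw [Finset.sup_insert, ih]
    simp only [Finset.sup_insert]
    rfl

end Ultraproduct

/-! ### The algebras of the sign systems and the generators of their ultraproduct -/

namespace LambdaSystem

variable {lam : Cardinal.{u}} {S : LambdaSystem lam}

/-- The algebra of a sign system. -/
abbrev SignSystem.Algebra (Q : S.SignSystem) : Type u :=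
  generatedAlgebra (splitSet S.f Q.A Q.G)

/-- The canonical generators of the algebra of a sign system. -/
def SignSystem.gen (Q : S.SignSystem) (β : lam.ord.ToType) : Q.Algebra :=
  ⟨splitSet S.f Q.A Q.G β, mem_generatedAlgebra _ β⟩

theorem SignSystem.gen_injective (Q : S.SignSystem) : Function.Injective Q.gen :=
  fun _ _ h => Q.sets_injective (congrArg Subtype.val h)

theorem SignSystem.baInvPlus_le (Q : S.SignSystem) (hlam : lam.IsRegular) :
    baInvPlus Q.Algebra theoryHCof ≤ lam :=
  baInvPlus_theoryHCof_le fun p hp =>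
    Q.exists_subset hlam (fun ξ => (p ξ).1) (Subtype.val_injective.comp hp) fun ξ => (p ξ).2

theorem SignSystem.infinite_algebra (Q : S.SignSystem) : Infinite Q.Algebra := by
  have : Infinite lam.ord.ToType := by
    rw [infinite_iff, mk_ord_toType]
    exact S.aleph0_lt.le
  exact Infinite.of_injective _ Q.gen_injective

theorem SignSystem.mem_of_le_sup (Q : S.SignSystem) {ι : Type*} (F : Finset ι)
    {γ : ι → lam.ord.ToType} {β : lam.ord.ToType} (h : Q.gen β ≤ F.sup fun j => Q.gen (γ j)) :
    ∃ j ∈ F, β ∈ splitSet S.f Q.A Q.G (γ j) := by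
  have hsup : ∀ F : Finset ι, ((F.sup fun j => Q.gen (γ j) : Q.Algebra) : Set lam.ord.ToType) =
      ⋃ j ∈ F, splitSet S.f Q.A Q.G (γ j) := by
    classical
    intro F
    induction F using Finset.induction_on with
    | empty => simp
    | insert a F _ ih =>
      rw [Finset.sup_insert, Finset.set_biUnion_insert, ← ih]
      rfl
  have h' : β ∈ ((F.sup fun j => Q.gen (γ j) : Q.Algebra) : Set lam.ord.ToType) :=
    h (self_mem_splitSet β)
  rw [hsup] at h'
  simpa using h'

theorem SignSystem.spread_range_gen {I : Type u} {D : Ultrafilter I} {Q : I → S.SignSystem}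
    (hQ : Pairwise fun ε ε' => Disjoint (Q ε).A (Q ε').A)
    (hD : ∀ s : Set I, s.Finite → s ∉ D) (k : ℕ) :
    spreadFormula k (Set.range fun β => Filter.Product.ofFamily (D : Filter I)
      fun ε => (Q ε).gen β) := by
  rintro _ ⟨β, rfl⟩ y - hy hle
  choose γ hγ using fun j => (hy j).1
  have hne : ∀ j, β ≠ γ j := fun j h => (hy j).2 (by rw [← hγ j, h])
  obtain rfl : (fun j => Filter.Product.ofFamily (D : Filter I) fun ε => (Q ε).gen (γ j)) = y :=
    funext hγ
  rw [Filter.Product.sup_ofFamily, Filter.Product.ofFamily_le] at hle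
  -- Each `γ j` contributes at most one `ε`, because its unique splitting level from `β` lies in at
  -- most one of the disjoint sets of levels.
  refine hD {ε | ∃ j, β ∈ splitSet S.f (Q ε).A (Q ε).G (γ j)} ?_ ?_
  · rw [Set.ofPred_exists]
    refine Set.finite_iUnion fun j => Set.Subsingleton.finite ?_
    rintro ε (h | ⟨i, hi, ha, hs, -⟩) ε' (h' | ⟨i', hi', ha', hs', -⟩)
    · exact absurd h (hne j)
    · exact absurd h (hne j)
    · exact absurd h' (hne j)
    · by_contra hεε
      obtain rfl := ha.split_unique hs ha' hs'
      exact Set.disjoint_left.1 (hQ hεε) hi hi'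
  · filter_upwards [hle] with ε hε
    obtain ⟨j, -, hj⟩ := (Q ε).mem_of_le_sup _ hε
    exact ⟨j, hj⟩

theorem SignSystem.mk_range_gen {I : Type u} (D : Ultrafilter I) (Q : I → S.SignSystem) :
    #(Set.range fun β => Filter.Product.ofFamily (D : Filter I) fun ε => (Q ε).gen β) = lam := by
  rw [mk_range_eq, mk_ord_toType]
  intro β β' h
  obtain ⟨ε, hε⟩ := (Filter.Product.ofFamily_eq.1 h).exists
  exact (Q ε).gen_injective hε

end LambdaSystem

theorem mainTheorem3 (lam κ θ : Cardinal.{u}) (hlam : lam.IsRegular)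
    (hsys : Nonempty (StrongLambdaSystem lam κ)) (hθ : ℵ₀ ≤ θ) (hθκ : θ ≤ κ) :
    ∃ (B : θ.ord.ToType → Type u) (_ : ∀ ε, BooleanAlgebra (B ε)),
      (∀ ε, Infinite (B ε)) ∧
      (∀ ε, baInvPlus (B ε) theoryHCof ≤ lam) ∧
      ∀ D : Ultrafilter θ.ord.ToType, (∀ S : Set θ.ord.ToType, BddAbove Sᶜ → S ∈ D) →
        lam < spreadPlus ((D : Filter θ.ord.ToType).Product B) ⊤ ∧
        ∀ μ : Cardinal.{u}, lam = Order.succ μ → μ ^ θ = μ →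
          cardinalUltraproduct D (fun ε => hereditaryCofinality (B ε)) <
            hereditaryCofinality ((D : Filter θ.ord.ToType).Product B) ∧
          cardinalUltraproduct D (fun ε => incomparability (B ε)) <
            incomparability ((D : Filter θ.ord.ToType).Product B) := by
  obtain ⟨S⟩ := hsys
  obtain ⟨Q, hQ⟩ := S.exists_signSystems (Θ := θ.ord.ToType) (hθ.trans hθκ) (by simpa using hθκ)
  refine ⟨fun ε => (Q ε).Algebra, fun _ => inferInstance, fun ε => (Q ε).infinite_algebra,
    fun ε => (Q ε).baInvPlus_le hlam, fun D hD => ?_⟩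
  have hfin : ∀ s : Set θ.ord.ToType, s.Finite → s ∉ D := by
    intro s hs hsD
    have : Nonempty θ.ord.ToType := by
      rw [← mk_ne_zero_iff, mk_ord_toType]
      exact (aleph0_pos.trans_le hθ).ne'
    exact Ultrafilter.compl_notMem_iff.2 hsD (hD sᶜ (by simpa using hs.bddAbove))
  have hspread := fun k => LambdaSystem.SignSystem.spread_range_gen hQ hfin k
  have hcard := LambdaSystem.SignSystem.mk_range_gen D Q
  have hinc := not_le_of_spreadFormula (hspread 0)
  refine ⟨?_, ?_⟩
  · refine (Order.lt_succ lam).trans_le ?_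
    refine (congrArg Order.succ hcard).symm.trans_le ?_
    exact succ_mk_le_baInvPlus (T := theorySpread ⊤) (R := fun _ _ => True) fun k _ => hspread k
  · rintro μ hμ hpow
    -- Each factor has both invariants at most `μ`, so the ultraproducts of the cardinals have size
    -- at most `μ ^ θ = μ`, while the diagonal generators form an antichain of size `lam`.
    have hle := fun ε => ((Q ε).baInvPlus_le hlam).trans_eq hμ
    have hlt : μ ^ #θ.ord.ToType < lam := by
      rw [mk_ord_toType, hpow, hμ]
      exact Order.lt_succ μ
    exact ⟨((cardinalUltraproduct_le D fun ε => hereditaryCofinality_le (hle ε)).trans_lt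
        hlt).trans_le (hcard.symm.trans_le (le_hereditaryCofinality hinc)),
      ((cardinalUltraproduct_le D fun ε => incomparability_le (hle ε)).trans_lt
        hlt).trans_le (hcard.symm.trans_le (le_incomparability hinc))⟩
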